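/- Let $K$ be a field, let $G$ be a simple graph with vertex set $[n]=\{1,\dots,n\}$, let $R=K[x_1,\dots,x_n,y_1,\dots,y_n]$, and let $$\mathcal{J}_G=(x_iy_j-x_jy_i : \{i,j\}\text{ is an edge of }G)\subseteq R$$ be the binomial edge ideal of $G$. Suppose that $G$ is $2$-vertex-connected, that is, $2<n$ and for every set $S\subseteq[n]$ with $|S|<2$ the graph induced by $G$ on $[n]\setminus S$ is connected, and that $G$ is not the complete graph on $[n]$. Then $R/\mathcal{J}_G$ is not an $S_2$ ring, where a Noetherian ring $T$ is called an $S_\ell$ ring if $\operatorname{depth}(T_{\mathfrak p})\ge\min\{\ell,\dim T_{\mathfrak p}\}$ for every prime ideal $\mathfrak p$ of $T$. In particular, $R/\mathcal{J}_G$ is not Cohen–Macaulay. -/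

import Mathlib

noncomputable section

namespace BinomialEdge

/-- A graph on a finite vertex set is `ℓ`-vertex-connected if it has more than `ℓ` vertices and
removing any set of fewer than `ℓ` vertices leaves a connected graph. -/
def IsVertexConnected {V : Type*} [Fintype V] (G : SimpleGraph V) (ℓ : ℕ) : Prop :=
  ℓ < Fintype.card V ∧
    ∀ S : Finset V, S.card < ℓ → (G.induce {v : V | v ∉ S}).Connected

/-- The polynomial ring `K[x_1, …, x_n, y_1, …, y_n]`: the variable `x_i` has the index
`Sum.inl i`, and `y_i` has the index `Sum.inr i`. -/
abbrev PolyRing (K : Type*) [Field K] (n : ℕ) : Type _ :=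
  MvPolynomial (Fin n ⊕ Fin n) K

/-- The variable `x_i`. -/
def xVar (K : Type*) [Field K] {n : ℕ} (i : Fin n) : PolyRing K n :=
  MvPolynomial.X (Sum.inl i)

/-- The variable `y_i`. -/
def yVar (K : Type*) [Field K] {n : ℕ} (i : Fin n) : PolyRing K n :=
  MvPolynomial.X (Sum.inr i)

/-- The binomial edge ideal of `G`, generated by the `x_i y_j - x_j y_i` for the edges `{i, j}`
of `G`. -/
def binomialEdgeIdeal (K : Type*) [Field K] {n : ℕ} (G : SimpleGraph (Fin n)) :
    Ideal (PolyRing K n) :=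
  Ideal.span {f | ∃ i j : Fin n, G.Adj i j ∧
    f = xVar K i * yVar K j - xVar K j * yVar K i}

/-- The depth of a local ring: the supremum of the lengths of the regular sequences in its
maximal ideal. -/
def localDepth (A : Type*) [CommRing A] [IsLocalRing A] : ℕ∞ :=
  ⨆ rs ∈ {rs : List A | RingTheory.Sequence.IsRegular A rs ∧
    ∀ r ∈ rs, r ∈ IsLocalRing.maximalIdeal A}, (rs.length : ℕ∞)

/-- Serre's condition `S_ℓ` for a Noetherian ring `T`: `depth T_𝔭 ≥ min {ℓ, dim T_𝔭}` for every
prime ideal `𝔭`. -/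
def IsSerre (T : Type*) [CommRing T] [IsNoetherianRing T] (ℓ : ℕ) : Prop :=
  ∀ (p : Ideal T) [p.IsPrime],
    min (ℓ : WithBot ℕ∞) (ringKrullDim (Localization.AtPrime p)) ≤
      (localDepth (Localization.AtPrime p) : WithBot ℕ∞)

/-- A Noetherian ring `T` is Cohen–Macaulay if `depth T_𝔭 = dim T_𝔭` for every prime ideal `𝔭`. -/
def IsCohenMacaulay (T : Type*) [CommRing T] [IsNoetherianRing T] : Prop :=
  ∀ (p : Ideal T) [p.IsPrime],
    (localDepth (Localization.AtPrime p) : WithBot ℕ∞) =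
      ringKrullDim (Localization.AtPrime p)

end BinomialEdge

end

namespace BinomialEdge

open IsLocalRing

/-! ### Depth and disconnected punctured spectra -/

section Depth

variable {A : Type*} [CommRing A]

/-! Let `P` be the prime of the generic rank-one matrix and `Q` the intersection of the minimal
primes not containing `P`, so the spectrum is V(P) ∪ V(Q). By 2-connectivity, a prime containing at
most one column contains all minors, since proportionality of columns spreads along paths; hence
every prime not above `P` contains two columns (`exists_pair_mem_of_not_ker_le`). A non-edge makes
`P + Q` proper.

Let `p` be a minimal prime over `P + Q`. The punctured spectrum at `p` is disconnected, so the depth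
there is at most one (Hartshorne, `localDepth_localization_le_one`). But `p` contains two columns
besides `P`, and killing them one at a time gives height at least two. Both conditions fail at `p`.
-/

lemma dvd_of_dvd_pow_mul {a b : A} (hb : ∀ x, a ∣ b * x → a ∣ x) (k : ℕ) (x : A)
    (h : a ∣ b ^ k * x) : a ∣ x := by
  induction k generalizing x with
  | zero => simpa using h
  | succ k ih => exact ih x (hb _ (by rwa [pow_succ', mul_assoc] at h))

/-- Cancel one factor `a` at a time. With the previous lemma, powers of a regular pair again form a
regular pair. -/
lemma pow_dvd_of_pow_dvd_mul {a b : A} (ha : ∀ x, a * x = 0 → x = 0)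
    (hb : ∀ x, a ∣ b * x → a ∣ x) (k : ℕ) (x : A) (h : a ^ k ∣ b * x) : a ^ k ∣ x := by
  induction k generalizing x with
  | zero => simp
  | succ k ih =>
    obtain ⟨y, rfl⟩ := hb x ((dvd_pow_self a k.succ_ne_zero).trans h)
    obtain ⟨z, hz⟩ := h
    have hbz : b * y = a ^ k * z := by
      refine sub_eq_zero.mp (ha _ ?_)
      linear_combination hz
    obtain ⟨w, rfl⟩ := ih y ⟨z, hbz⟩
    exact ⟨w, by ring⟩

lemma pow_mul_eq_zero {a : A} (ha : ∀ x, a * x = 0 → x = 0) (k : ℕ) (x : A)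
    (h : a ^ k * x = 0) : x = 0 := by
  induction k with
  | zero => simpa using h
  | succ k ih => exact ih (ha _ (by rw [← h]; ring))

/-- If two ideals of a local ring multiply to zero and their sum contains a regular sequence of
length two, then one of them vanishes. -/
lemma eq_bot_or_eq_bot_of_regular_pair [IsLocalRing A] {I J : Ideal A} (hIJ : I * J = ⊥)
    {a b : A} (ha : ∀ x, a * x = 0 → x = 0) (hb : ∀ x, a ∣ b * x → a ∣ x)
    (haIJ : a ∈ I ⊔ J) (hbIJ : b ∈ I ⊔ J) : I = ⊥ ∨ J = ⊥ := by
  have hmul : ∀ i ∈ I, ∀ j ∈ J, i * j = 0 := fun i hi j hj => by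
    simpa [hIJ] using Ideal.mul_mem_mul hi hj
  obtain ⟨i, hi, j, hj, rfl⟩ := Submodule.mem_sup.mp haIJ
  obtain ⟨i', hi', j', hj', rfl⟩ := Submodule.mem_sup.mp hbIJ
  have h1 := hmul i hi j' hj'
  have h2 := hmul i' hi' j hj
  -- As mixed products vanish, `b * i = i' * i = a * i'`, so `a` divides `i`.
  obtain ⟨c, hc⟩ := hb i ⟨i', by linear_combination h1 - h2⟩
  have hc' : j = (i + j) * (1 - c) := by linear_combination -hc
  rcases IsLocalRing.isUnit_or_isUnit_one_sub_self c with h | h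
  · right
    refine (Submodule.eq_bot_iff _).mpr fun z hz => ha z ?_
    refine (h.mul_left_eq_zero (a := (i + j) * z)).mp ?_
    rw [mul_right_comm, ← hc]
    exact hmul i hi z hz
  · left
    refine (Submodule.eq_bot_iff _).mpr fun z hz => ha z ?_
    refine (h.mul_left_eq_zero (a := (i + j) * z)).mp ?_
    rw [mul_right_comm, ← hc', mul_comm]
    exact hmul z hz j hj

/-- Hartshorne's connectedness criterion: a Noetherian local ring whose punctured spectrum is
disconnected has depth at most one. -/
lemma localDepth_le_one_of_mul_le_nilradical [IsLocalRing A] [IsNoetherianRing A] {I J : Ideal A}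
    (hIJ : I * J ≤ nilradical A) (hmax : maximalIdeal A ≤ (I ⊔ J).radical)
    (hI : ¬ I ≤ nilradical A) (hJ : ¬ J ≤ nilradical A) : localDepth A ≤ 1 := by
  refine iSup₂_le ?_
  rintro rs ⟨hreg, hmem⟩
  match rs, hreg, hmem with
  | [], _, _ => simp
  | [_], _, _ => simp
  | a :: b :: l, hreg, hmem =>
    exfalso
    have hw := hreg.toIsWeaklyRegular
    rw [RingTheory.Sequence.isWeaklyRegular_cons_iff,
      RingTheory.Sequence.isWeaklyRegular_cons_iff] at hw
    obtain ⟨ha, hb, -⟩ := hw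
    have ha' : ∀ x, a * x = 0 → x = 0 := fun x hx => ha (by simpa using hx)
    have hb' : ∀ x, a ∣ b * x → a ∣ x := by
      rintro x ⟨y, hy⟩
      have := mem_of_isSMulRegular_quotient_of_smul_mem hb (x := x) (by
        rw [smul_eq_mul, hy]
        exact Submodule.smul_mem_pointwise_smul y a ⊤ trivial)
      obtain ⟨z, -, hz⟩ := (Submodule.mem_smul_pointwise_iff_exists _ _ _).mp this
      exact ⟨z, hz.symm⟩
    -- Passing to powers of the ideals makes their product exactly zero; `a` and `b` are then
    -- replaced by powers lying in the new sum.
    obtain ⟨N, hN⟩ := Ideal.exists_pow_le_of_le_radical_of_fg hIJ (IsNoetherian.noetherian _)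
    have hN' : I ^ N * J ^ N = ⊥ := by
      rw [← mul_pow]; exact le_bot_iff.mp hN
    have hpow : ∀ c ∈ maximalIdeal A, ∃ k, c ^ k ∈ I ^ N ⊔ J ^ N := fun c hc => by
      obtain ⟨k, hk⟩ := hmax hc
      refine ⟨k * (N + N), Ideal.sup_pow_add_le_pow_sup_pow ?_⟩
      rw [pow_mul]
      exact Ideal.pow_mem_pow hk _
    obtain ⟨k, hk⟩ := hpow a (hmem a (by simp))
    obtain ⟨m, hm⟩ := hpow b (hmem b (by simp))
    have hnil : ∀ L : Ideal A, L ^ N = ⊥ → L ≤ nilradical A := fun L hL z hz =>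
      ⟨N, by simpa [hL] using Ideal.pow_mem_pow hz N⟩
    rcases eq_bot_or_eq_bot_of_regular_pair hN' (fun x => pow_mul_eq_zero ha' k x)
      (fun x => dvd_of_dvd_pow_mul (fun y => pow_dvd_of_pow_dvd_mul ha' hb' k y) m x) hk hm with h | h
    · exact hI (hnil I h)
    · exact hJ (hnil J h)

/-- If the spectrum of a Noetherian ring is the union of two closed sets, then at the generic
points of their intersection which lie in the closure of both complements the depth is at most
one. -/
lemma localDepth_localization_le_one [IsNoetherianRing A] {I J p Q Q' : Ideal A} [p.IsPrime]
    (hIJ : I * J ≤ nilradical A) (hp : p ∈ (I ⊔ J).minimalPrimes)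
    (hQ : Q.IsPrime) (hQp : Q ≤ p) (hIQ : ¬ I ≤ Q)
    (hQ' : Q'.IsPrime) (hQp' : Q' ≤ p) (hJQ : ¬ J ≤ Q') :
    localDepth (Localization.AtPrime p) ≤ 1 := by
  have : IsNoetherianRing (Localization.AtPrime p) :=
    IsLocalization.isNoetherianRing p.primeCompl _ inferInstance
  set f := algebraMap A (Localization.AtPrime p)
  have key : ∀ {L q : Ideal A}, q.IsPrime → q ≤ p → ¬ L ≤ q →
      ¬ L.map f ≤ nilradical (Localization.AtPrime p) := by
    intro L q hq hqp hLq h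
    have hd : Disjoint (p.primeCompl : Set A) q :=
      Set.disjoint_left.mpr fun x hx hxq => hx (hqp hxq)
    have hprime := IsLocalization.isPrime_of_isPrime_disjoint p.primeCompl
      (Localization.AtPrime p) q hq hd
    have h' := Ideal.map_le_iff_le_comap.mp (h.trans (nilradical_le_prime (q.map f)))
    have := IsLocalization.under_map_of_isPrime_disjoint p.primeCompl
      (Localization.AtPrime p) hq hd
    exact hLq (h'.trans this.le)
  refine localDepth_le_one_of_mul_le_nilradical (I := I.map f) (J := J.map f) ?_ ?_
    (key hQ hQp hIQ) (key hQ' hQp' hJQ)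
  · rw [← Ideal.map_mul, Ideal.map_le_iff_le_comap]
    intro x hx
    exact (mem_nilradical.mp (hIJ hx)).map f
  · rw [← Ideal.map_sup, Ideal.radical_eq_sInf]
    refine le_sInf ?_
    rintro q ⟨hq, hqp⟩
    rw [← Localization.AtPrime.map_eq_maximalIdeal, Ideal.map_le_iff_le_comap]
    -- By minimality of `p`, a prime of the localization above `I ⊔ J` contracts to `p`, so it is
    -- maximal.
    refine hp.2 ⟨hqp.comap f, Ideal.map_le_iff_le_comap.mp hq⟩ ?_
    have := Ideal.comap_mono (f := f) (IsLocalRing.le_maximalIdeal hqp.ne_top)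
    exact this.trans Localization.AtPrime.under_maximalIdeal.le

end Depth

/-! ### Primes of the coordinate ring and rank-one matrices -/

section EdgeRing

variable {K : Type*} [Field K] {n : ℕ}

/-- The coordinate ring of the binomial edge ideal. -/
abbrev EdgeRing (K : Type*) [Field K] {n : ℕ} (G : SimpleGraph (Fin n)) : Type _ :=
  PolyRing K n ⧸ binomialEdgeIdeal K G

variable (K) in
/-- The class of `x_i` in the coordinate ring. -/
noncomputable def xCl (G : SimpleGraph (Fin n)) (i : Fin n) : EdgeRing K G :=
  Ideal.Quotient.mk _ (xVar K i)

variable (K) in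
/-- The class of `y_i` in the coordinate ring. -/
noncomputable def yCl (G : SimpleGraph (Fin n)) (i : Fin n) : EdgeRing K G :=
  Ideal.Quotient.mk _ (yVar K i)

variable {G : SimpleGraph (Fin n)}

lemma xCl_mul_yCl_of_adj {i j : Fin n} (h : G.Adj i j) :
    xCl K G i * yCl K G j = xCl K G j * yCl K G i := by
  have : xVar K i * yVar K j - xVar K j * yVar K i ∈ binomialEdgeIdeal K G :=
    Ideal.subset_span ⟨i, j, h, rfl⟩
  have h' := Ideal.Quotient.eq_zero_iff_mem.mpr this
  rw [map_sub, map_mul, map_mul] at h'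
  exact sub_eq_zero.mp h'

section Point

variable {L : Type*} [CommRing L] [Algebra K L]

/-- The algebra map out of the coordinate ring given by a `2 × n` matrix whose minors on the edges
vanish. -/
noncomputable def point (u v : Fin n → L) (h : ∀ i j, G.Adj i j → u i * v j = u j * v i) :
    EdgeRing K G →ₐ[K] L :=
  Ideal.Quotient.liftₐ _ (MvPolynomial.aeval (Sum.elim u v)) (by
    intro f hf
    change f ∈ RingHom.ker (MvPolynomial.aeval (Sum.elim u v) : PolyRing K n →ₐ[K] L)
    refine (Ideal.span_le.mpr ?_) hf
    rintro _ ⟨i, j, hij, rfl⟩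
    simp [xVar, yVar, RingHom.mem_ker, h i j hij])

@[simp] lemma point_xCl (u v : Fin n → L) (h : ∀ i j, G.Adj i j → u i * v j = u j * v i)
    (i : Fin n) : point (K := K) u v h (xCl K G i) = u i := by
  change MvPolynomial.aeval (Sum.elim u v) (xVar K i) = u i
  simp [xVar]

@[simp] lemma point_yCl (u v : Fin n → L) (h : ∀ i j, G.Adj i j → u i * v j = u j * v i)
    (i : Fin n) : point (K := K) u v h (yCl K G i) = v i := by
  change MvPolynomial.aeval (Sum.elim u v) (yVar K i) = v i
  simp [yVar]

lemma edgeRing_algHom_ext {f g : EdgeRing K G →ₐ[K] L}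
    (hx : ∀ i, f (xCl K G i) = g (xCl K G i)) (hy : ∀ i, f (yCl K G i) = g (yCl K G i)) :
    f = g := by
  refine Ideal.Quotient.algHom_ext _ (MvPolynomial.algHom_ext ?_)
  rintro (i | i)
  · exact hx i
  · exact hy i

end Point

lemma exists_rank_one_factorization {ι L : Type*} [Field L] (u v : ι → L)
    (h : ∀ i j, u i * v j = u j * v i) :
    ∃ (s : ι → L) (t w : L), ∀ i, u i = s i * t ∧ v i = s i * w := by
  by_cases hu : ∃ i, u i ≠ 0
  · obtain ⟨i, hi⟩ := hu
    refine ⟨fun j => u j / u i, u i, v i, fun j => ⟨by field_simp, ?_⟩⟩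
    field_simp
    linear_combination h i j
  · push Not at hu
    exact ⟨v, 0, 1, fun i => by simp [hu i]⟩

/-- Every prime of an algebra over a field is the kernel of an algebra map to a field. -/
lemma exists_algHom_field_eq_zero_iff.{v} (K : Type*) [Field K] {T : Type v}
    [CommRing T] [Algebra K T]
    (q : Ideal T) [q.IsPrime] :
    ∃ (L : Type v) (_ : Field L) (_ : Algebra K L) (π : T →ₐ[K] L), ∀ f, π f = 0 ↔ f ∈ q := by
  refine ⟨FractionRing (T ⧸ q), inferInstance, inferInstance,
    (IsScalarTower.toAlgHom K (T ⧸ q) (FractionRing (T ⧸ q))).comp (Ideal.Quotient.mkₐ K q),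
    fun f => ?_⟩
  rw [AlgHom.comp_apply, IsScalarTower.toAlgHom_apply, Ideal.Quotient.mkₐ_eq_mk,
    FaithfulSMul.algebraMap_eq_zero_iff, Ideal.Quotient.eq_zero_iff_mem]

variable (K) in
/-- The generic `2 × n` matrix of rank one whose columns in `U` vanish. -/
noncomputable def rankOnePoint (G : SimpleGraph (Fin n)) (U : Finset (Fin n)) :
    EdgeRing K G →ₐ[K] MvPolynomial (Fin n ⊕ Bool) K :=
  point (fun i => if i ∈ U then 0 else .X (.inl i) * .X (.inr true))
    (fun i => if i ∈ U then 0 else .X (.inl i) * .X (.inr false))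
    (fun i j _ => by split_ifs <;> ring)

/-- Over the residue field of `q` the matrix has rank at most one, hence factors as `s i * (t, w)`
and specializes the generic one. No generators of the kernel are needed. -/
lemma ker_rankOnePoint_le {U : Finset (Fin n)} {q : Ideal (EdgeRing K G)} [q.IsPrime]
    (hminor : ∀ i j, xCl K G i * yCl K G j - xCl K G j * yCl K G i ∈ q)
    (hx : ∀ i ∈ U, xCl K G i ∈ q) (hy : ∀ i ∈ U, yCl K G i ∈ q) :
    RingHom.ker (rankOnePoint K G U) ≤ q := by
  obtain ⟨L, _, _, π, hπ⟩ := exists_algHom_field_eq_zero_iff K q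
  obtain ⟨s, t, w, hs⟩ := exists_rank_one_factorization (fun i => π (xCl K G i))
    (fun i => π (yCl K G i)) (fun i j => by
      have := (hπ _).mpr (hminor i j)
      rw [map_sub, map_mul, map_mul] at this
      exact sub_eq_zero.mp this)
  let ψ : MvPolynomial (Fin n ⊕ Bool) K →ₐ[K] L :=
    MvPolynomial.aeval (Sum.elim s (fun b => if b then t else w))
  have hcomp : ψ.comp (rankOnePoint K G U) = π := by
    refine edgeRing_algHom_ext (fun i => ?_) (fun i => ?_)
    · by_cases hi : i ∈ U
      · simp [rankOnePoint, hi, (hπ _).mpr (hx i hi)]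
      · simp [rankOnePoint, hi, ψ, (hs i).1]
    · by_cases hi : i ∈ U
      · simp [rankOnePoint, hi, (hπ _).mpr (hy i hi)]
      · simp [rankOnePoint, hi, ψ, (hs i).2]
  intro f hf
  rw [← hπ, ← hcomp, AlgHom.comp_apply, (RingHom.mem_ker).mp hf, map_zero]

lemma xCl_mem_ker_rankOnePoint {U : Finset (Fin n)} {i : Fin n} :
    xCl K G i ∈ RingHom.ker (rankOnePoint K G U) ↔ i ∈ U := by
  simp [RingHom.mem_ker, rankOnePoint]

lemma minor_mem_ker_rankOnePoint (U : Finset (Fin n)) (i j : Fin n) :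
    xCl K G i * yCl K G j - xCl K G j * yCl K G i ∈ RingHom.ker (rankOnePoint K G U) := by
  simp only [RingHom.mem_ker, rankOnePoint, map_sub, map_mul, point_xCl, point_yCl]
  split_ifs <;> ring

/-- A prime of the coordinate ring of a `2`-connected graph that does not lie in the closure of
the rank one locus contains the variables of two vertices. -/
lemma exists_pair_mem_of_not_ker_le (hconn : IsVertexConnected G 2)
    {q : Ideal (EdgeRing K G)} (hq : q.IsPrime)
    (h : ¬ RingHom.ker (rankOnePoint K G ∅) ≤ q) :
    ∃ i j, i ≠ j ∧ (xCl K G i ∈ q ∧ yCl K G i ∈ q) ∧ (xCl K G j ∈ q ∧ yCl K G j ∈ q) := by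
  classical
  by_contra hne
  push Not at hne
  let Z : Finset (Fin n) := {i | xCl K G i ∈ q ∧ yCl K G i ∈ q}
  have hZ : Z.card < 2 := by
    rw [Nat.lt_succ_iff, Finset.card_le_one]
    intro i hi j hj
    simp only [Z, Finset.mem_filter, Finset.mem_univ, true_and] at hi hj
    by_contra hij
    exact hne i j hij hi hj.1 hj.2
  have hpre := (hconn.2 Z hZ).preconnected
  refine h (ker_rankOnePoint_le (fun i j => ?_) (by simp) (by simp))
  by_cases hi : i ∈ Z
  · simp only [Z, Finset.mem_filter, Finset.mem_univ, true_and] at hi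
    exact q.sub_mem (q.mul_mem_right _ hi.1) (q.mul_mem_left _ hi.2)
  by_cases hj : j ∈ Z
  · simp only [Z, Finset.mem_filter, Finset.mem_univ, true_and] at hj
    exact q.sub_mem (q.mul_mem_left _ hj.2) (q.mul_mem_right _ hj.1)
  have hreach : ∀ v : {v : Fin n | v ∉ Z},
      Relation.ReflTransGen (G.induce {v : Fin n | v ∉ Z}).Adj ⟨i, hi⟩ v →
      xCl K G i * yCl K G v - xCl K G v * yCl K G i ∈ q := by
    intro v hv
    induction hv with
    | refl => simp
    | @tail b c _ hbc ih =>
      have hbc' := xCl_mul_yCl_of_adj (K := K) (G := G) (SimpleGraph.induce_adj.mp hbc)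
      -- Column `b` is nonzero modulo `q`, so one of its entries can be cancelled.
      have hb : ¬ (xCl K G b ∈ q ∧ yCl K G b ∈ q) := fun hb => b.2 (by simp [Z, hb])
      rw [not_and_or] at hb
      rcases hb with hb | hb
      · refine (hq.mem_or_mem (x := xCl K G b) ?_).resolve_left hb
        convert q.mul_mem_left (xCl K G c) ih using 1
        linear_combination xCl K G i * hbc'
      · refine (hq.mem_or_mem (x := yCl K G b) ?_).resolve_left hb
        convert q.mul_mem_left (yCl K G c) ih using 1
        linear_combination yCl K G i * hbc'
  exact hreach ⟨j, hj⟩ ((SimpleGraph.reachable_iff_reflTransGen _ _).mp (hpre _ _))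

end EdgeRing

/-! ### A localization of small depth and large dimension -/

section NotSerre

variable {K : Type*} [Field K] {n : ℕ} {G : SimpleGraph (Fin n)}

variable (K) in
/-- The irrelevant maximal ideal contains the closure of the rank one locus together with a prime
outside of it, provided that the graph is not complete. -/
lemma exists_prime_not_ker_le (hcomplete : G ≠ ⊤) :
    ∃ m q : Ideal (EdgeRing K G), m.IsPrime ∧ q.IsPrime ∧ q ≤ m ∧
      RingHom.ker (rankOnePoint K G ∅) ≤ m ∧ ¬ RingHom.ker (rankOnePoint K G ∅) ≤ q := by
  classical
  obtain ⟨a, b, hab, hadj⟩ : ∃ a b, a ≠ b ∧ ¬ G.Adj a b := by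
    by_contra h
    push Not at h
    exact hcomplete (SimpleGraph.ext (by
      ext i j
      exact ⟨fun hij => hij.ne, fun hij => h i j hij⟩))
  have hba : ¬ G.Adj b a := fun h => hadj h.symm
  -- Columns `a` and `b` are generic and the others zero: no edge imposes a condition, and the minor
  -- of `a`, `b` survives.
  let φ : EdgeRing K G →ₐ[K] PolyRing K n := point
    (fun i => if i = a ∨ i = b then xVar K i else 0)
    (fun i => if i = a ∨ i = b then yVar K i else 0) (by
      intro i j hij
      by_cases hi : i = a ∨ i = b <;> by_cases hj : j = a ∨ j = b <;> simp only [hi, hj, if_true,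
        if_false, mul_zero, zero_mul]
      rcases hi with rfl | rfl <;> rcases hj with rfl | rfl <;>
        first | exact absurd hij (G.irrefl) | contradiction)
  let ε : EdgeRing K G →ₐ[K] K := point 0 0 (by simp)
  have hεx : ∀ i, ε (xCl K G i) = 0 := fun i => by simp [ε]
  have hεy : ∀ i, ε (yCl K G i) = 0 := fun i => by simp [ε]
  refine ⟨RingHom.ker ε, RingHom.ker φ, RingHom.ker_isPrime _, RingHom.ker_isPrime _, ?_, ?_, ?_⟩
  · have hcomp : (MvPolynomial.aeval (0 : Fin n ⊕ Fin n → K)).comp φ = ε := by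
      refine edgeRing_algHom_ext (fun i => ?_) (fun i => ?_)
      · simp only [AlgHom.comp_apply, φ, point_xCl, hεx]
        split_ifs <;> simp [xVar]
      · simp only [AlgHom.comp_apply, φ, point_yCl, hεy]
        split_ifs <;> simp [yVar]
    intro f hf
    rw [RingHom.mem_ker, ← hcomp, AlgHom.comp_apply, RingHom.mem_ker.mp hf, map_zero]
  · have := RingHom.ker_isPrime ε
    exact ker_rankOnePoint_le (fun i j => by simp [RingHom.mem_ker, hεx]) (by simp) (by simp)
  · intro h
    have hmem := h (minor_mem_ker_rankOnePoint ∅ a b)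
    simp only [RingHom.mem_ker, φ, map_sub, map_mul, point_xCl, point_yCl, true_or, or_true,
      if_true] at hmem
    have := congrArg (MvPolynomial.eval
      (Sum.elim (fun i => if i = a then 1 else 0) (fun i => if i = b then (1 : K) else 0))) hmem
    simp [xVar, yVar, hab, hab.symm] at this

variable (K) in
/-- The coordinate ring of a non-complete `2`-connected graph has a localization at a prime which
has depth at most one and dimension at least two. -/
lemma exists_localDepth_le_one (hconn : IsVertexConnected G 2) (hcomplete : G ≠ ⊤) :
    ∃ (p : Ideal (EdgeRing K G)) (_ : p.IsPrime),
      localDepth (Localization.AtPrime p) ≤ 1 ∧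
        (2 : WithBot ℕ∞) ≤ ringKrullDim (Localization.AtPrime p) := by
  classical
  obtain ⟨m, q₀, hm, hq₀, hq₀m, hPm, hPq₀⟩ := exists_prime_not_ker_le K hcomplete
  set P := RingHom.ker (rankOnePoint K G ∅)
  have hP : P.IsPrime := RingHom.ker_isPrime _
  let S : Set (Ideal (EdgeRing K G)) := {q | q ∈ minimalPrimes (EdgeRing K G) ∧ ¬ P ≤ q}
  have hS : S.Finite := (minimalPrimes.finite_of_isNoetherianRing _).subset fun q hq => hq.1
  have hSprime : ∀ q ∈ S, q.IsPrime := fun q hq => hq.1.1.1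
  have hle : ∀ r : Ideal (EdgeRing K G), r.IsPrime → sInf S ≤ r → ∃ q ∈ S, q ≤ r := by
    intro r hr h
    rw [← hS.coe_toFinset, ← Finset.inf_id_eq_sInf, hr.inf_le'] at h
    obtain ⟨q, hq, hqr⟩ := h
    exact ⟨q, hS.mem_toFinset.mp hq, hqr⟩
  obtain ⟨q₁, hq₁, hq₁₀⟩ := Ideal.exists_minimalPrimes_le (bot_le : (⊥ : Ideal _) ≤ q₀)
  have hq₁S : q₁ ∈ S := ⟨hq₁, fun h => hPq₀ (h.trans hq₁₀)⟩
  have hm' : P ⊔ sInf S ≤ m := sup_le hPm ((sInf_le hq₁S).trans (hq₁₀.trans hq₀m))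
  obtain ⟨p, hp, -⟩ := Ideal.exists_minimalPrimes_le hm'
  have hpp : p.IsPrime := hp.1.1
  have hPp : P ≤ p := le_sup_left.trans hp.1.2
  obtain ⟨q, hqS, hqp⟩ := hle p hpp (le_sup_right.trans hp.1.2)
  obtain ⟨i, j, hij, ⟨hxi, hyi⟩, hxj, -⟩ :=
    exists_pair_mem_of_not_ker_le hconn (hSprime q hqS) hqS.2
  -- Members of `S` contain variables, whereas `P` contains none.
  have hSP : ¬ sInf S ≤ P := fun h => by
    obtain ⟨r, hrS, hrP⟩ := hle P hP h
    obtain ⟨k, -, -, ⟨hk, -⟩, -⟩ := exists_pair_mem_of_not_ker_le hconn (hSprime r hrS) hrS.2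
    simpa using xCl_mem_ker_rankOnePoint.mp (hrP hk)
  refine ⟨p, hpp, ?_, ?_⟩
  · refine localDepth_localization_le_one ?_ hp (hSprime q hqS) hqp hqS.2 hP hPp hSP
    rw [nilradical, ← Ideal.sInf_minimalPrimes]
    refine le_sInf fun r hr => ?_
    by_cases h : P ≤ r
    · exact Ideal.mul_le_left.trans h
    · exact Ideal.mul_le_right.trans (sInf_le ⟨hr, h⟩)
  -- The chain is `P`, then `P` with column `i` killed, then `p`; `x_i` and `x_j` witness
  -- strictness.
  · have hP₁ : (RingHom.ker (rankOnePoint K G {i})).IsPrime := RingHom.ker_isPrime _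
    have h₁ : P < RingHom.ker (rankOnePoint K G {i}) := by
      refine lt_of_le_not_ge
        (ker_rankOnePoint_le (minor_mem_ker_rankOnePoint {i}) (by simp) (by simp)) fun h => ?_
      have := h (xCl_mem_ker_rankOnePoint.mpr (Finset.mem_singleton_self i))
      simpa using xCl_mem_ker_rankOnePoint.mp this
    have h₂ : RingHom.ker (rankOnePoint K G {i}) < p := by
      refine lt_of_le_not_ge
        (ker_rankOnePoint_le (fun k l => hPp (minor_mem_ker_rankOnePoint ∅ k l))
          (by simpa using hqp hxi) (by simpa using hqp hyi)) fun h => ?_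
      exact hij (Finset.mem_singleton.mp (xCl_mem_ker_rankOnePoint.mp (h (hqp hxj)))).symm
    rw [IsLocalization.AtPrime.ringKrullDim_eq_height p (Localization.AtPrime p)]
    have e₁ := Ideal.height_add_one_le_of_lt_of_isPrime h₁
    have e₂ := Ideal.height_add_one_le_of_lt_of_isPrime h₂
    have : (2 : ℕ∞) ≤ p.height := calc
      (2 : ℕ∞) = 0 + 1 + 1 := by norm_num
      _ ≤ P.height + 1 + 1 := by gcongr; exact zero_le
      _ ≤ _ := (add_le_add_left e₁ 1).trans e₂
    exact WithBot.coe_le_coe.mpr this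

end NotSerre

end BinomialEdge

theorem proposition3p9 {K : Type*} [Field K] {n : ℕ} (G : SimpleGraph (Fin n))
    (hconn : BinomialEdge.IsVertexConnected G 2) (hcomplete : G ≠ ⊤) :
    ¬ BinomialEdge.IsSerre
        (BinomialEdge.PolyRing K n ⧸ BinomialEdge.binomialEdgeIdeal K G) 2 ∧
      ¬ BinomialEdge.IsCohenMacaulay
        (BinomialEdge.PolyRing K n ⧸ BinomialEdge.binomialEdgeIdeal K G) := by
  obtain ⟨p, hp, hdepth, hdim⟩ := BinomialEdge.exists_localDepth_le_one K hconn hcomplete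
  have hlt : (BinomialEdge.localDepth (Localization.AtPrime p) : WithBot ℕ∞) < 2 :=
    lt_of_le_of_lt (b := ((1 : ℕ∞) : WithBot ℕ∞)) (WithBot.coe_le_coe.mpr hdepth)
      (WithBot.coe_lt_coe.mpr (by norm_num : (1 : ℕ∞) < 2))
  refine ⟨fun h => ?_, fun h => ?_⟩
  · exact absurd ((le_min le_rfl hdim).trans (h p)) (not_le.mpr hlt)
  · exact absurd (hdim.trans (h p).ge) (not_le.mpr hlt)
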